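/- A product formula $F$ with $N$ exponentials is a finite sequence $(C_1,s_1),\dots,(C_N,s_N)$, where each $C_j$ is one of the two symbols $A,B$ and each $s_j\in\mathbb{R}$. Its value at operators $A,B$ is $F(A,B)=e^{s_1C_1}e^{s_2C_2}\cdots e^{s_NC_N}$. Norms are spectral norms. Theorem. Any product formula approximation for $e^{[A,B]T}$ for generic $A,B$ consists of $\Omega(T)$ exponentials. Precisely: for every error tolerance $0\le\varepsilon<\sqrt2$ there are constants $c>0$ and $T_0$, depending only on $\varepsilon$, such that for every $T\ge T_0$: (1) every product formula $F$ that satisfies $\|F(A,B)-e^{[A,B]T}\|\le\varepsilon$ for all anti-Hermitian operators $A,B$ on $\mathbb{C}^n$ with $\|A\|,\|B\|\le1$, for all $n$, consists of at least $cT$ exponentials; (2) moreover, there are a finite dimension $n$ and anti-Hermitian operators $A,B$ on $\mathbb{C}^n$ with $\|A\|,\|B\|\le1$ such that every product formula $F$ with $\|F(A,B)-e^{[A,B]T}\|\le\varepsilon$ at this one pair, even if $F$ is chosen depending on $n$, $A$, $B$ and $T$, consists of at least $cT$ exponentials. -/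

import Mathlib

/-- The two elementary operators of a product formula. -/
inductive Generator where
  | A
  | B

/-- A product formula in two operators: a finite sequence of elementary exponentials, each given
by the operator that is exponentiated and a real evolution time (of either sign). -/
abbrev ProductFormula := List (Generator × ℝ)

/-- The operator that a generator stands for. -/
def Generator.toOp {H : Type*} [NormedAddCommGroup H] [InnerProductSpace ℂ H]
    (A B : H →L[ℂ] H) : Generator → (H →L[ℂ] H)
  | .A => A
  | .B => B

namespace ProductFormula

/-- The number of exponentials. The cost of each is one, independently of its time. -/
def numExp (F : ProductFormula) : ℕ := F.length

/-- The value `exp (s₁ C₁) * ⋯ * exp (s_N C_N)`, each `C_j` being `A` or `B`, of a product formula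
at the operators `A` and `B`. -/
noncomputable def eval {H : Type*} [NormedAddCommGroup H] [InnerProductSpace ℂ H]
    (F : ProductFormula) (A B : H →L[ℂ] H) : H →L[ℂ] H :=
  (F.map fun f => NormedSpace.exp ((f.2 : ℂ) • f.1.toOp A B)).prod

/-- `F` approximates `exp ([A,B] T)` within error `ε` in spectral norm, at the operators `A`, `B`. -/
def Approximates {H : Type*} [NormedAddCommGroup H] [InnerProductSpace ℂ H]
    (F : ProductFormula) (A B : H →L[ℂ] H) (T ε : ℝ) : Prop :=
  ‖F.eval A B - NormedSpace.exp ((T : ℂ) • ⁅A, B⁆)‖ ≤ ε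

/-- `F` approximates `exp ([A,B] T)` within error `ε` for generic `A`, `B`, that is, the same
formula works for all anti-Hermitian `A`, `B` of norm at most one in every finite dimension. -/
def ApproximatesGeneric (F : ProductFormula) (T ε : ℝ) : Prop :=
  ∀ (n : ℕ) (A B : EuclideanSpace ℂ (Fin n) →L[ℂ] EuclideanSpace ℂ (Fin n)),
    A ∈ skewAdjoint (EuclideanSpace ℂ (Fin n) →L[ℂ] EuclideanSpace ℂ (Fin n)) →
    B ∈ skewAdjoint (EuclideanSpace ℂ (Fin n) →L[ℂ] EuclideanSpace ℂ (Fin n)) →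
    ‖A‖ ≤ 1 → ‖B‖ ≤ 1 → F.Approximates A B T ε

end ProductFormula

/-! One fixed pair suffices for both claims. On the path `0, …, 2m`, let `A` and `B` hop along the
two alternating matchings. An exponential of either mixes only matched sites, so it spreads the
support of a vector by at most one site. The commutator instead hops between even sites; with
weights `√((k+1)(m-k))` on `B` it is there the rotation generator of a spin `m/2`, whose coherent
states solve the evolution (`hasDerivAt_coherentState`). Scaling the weights by `π/(2T)` makes `exp
(T [A,B])` carry site `0` exactly to site `2m` (`exp_commutator_hop_apply`) and keeps `‖B‖ ≤ 1` for
`m` up to `T`. A formula with fewer than `2m` exponentials leaves site `2m` empty: its output is a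
unit vector orthogonal to the target, at distance `√2 > ε`. -/

/-- The operator `(L v) i = a i * v (σ i)`, a permutation of the coordinates followed by weights. -/
noncomputable def weightedPerm {ι : Type*} [Fintype ι] (σ : Equiv.Perm ι) (a : ι → ℂ) :
    EuclideanSpace ℂ ι →L[ℂ] EuclideanSpace ℂ ι :=
  LinearMap.toContinuousLinearMap
    { toFun := fun v => WithLp.toLp 2 (fun i => a i * v (σ i))
      map_add' := fun v w => by ext i; simp [mul_add]
      map_smul' := fun c v => by ext i; simp [mul_left_comm] }

section WeightedPerm

variable {ι : Type*} [Fintype ι]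

@[simp]
theorem weightedPerm_apply (σ : Equiv.Perm ι) (a : ι → ℂ) (v : EuclideanSpace ℂ ι) (i : ι) :
    weightedPerm σ a v i = a i * v (σ i) := rfl

theorem norm_weightedPerm_le_one (σ : Equiv.Perm ι) (a : ι → ℂ) (ha : ∀ i, ‖a i‖ ≤ 1) :
    ‖weightedPerm σ a‖ ≤ 1 := by
  refine ContinuousLinearMap.opNorm_le_bound _ zero_le_one fun v => ?_
  rw [one_mul, EuclideanSpace.norm_eq, EuclideanSpace.norm_eq]
  apply Real.sqrt_le_sqrt
  rw [← Equiv.sum_comp σ fun i => ‖v i‖ ^ 2]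
  refine Finset.sum_le_sum fun i _ => ?_
  rw [weightedPerm_apply, norm_mul]
  gcongr
  exact mul_le_of_le_one_left (norm_nonneg _) (ha i)

theorem weightedPerm_mem_skewAdjoint (σ : Equiv.Perm ι) (a : ι → ℂ)
    (hσ : ∀ i, σ (σ i) = i) (ha : ∀ i, star (a (σ i)) = -a i) :
    weightedPerm σ a ∈ skewAdjoint (EuclideanSpace ℂ ι →L[ℂ] EuclideanSpace ℂ ι) := by
  rw [skewAdjoint.mem_iff, ContinuousLinearMap.star_eq_adjoint]
  symm
  rw [ContinuousLinearMap.eq_adjoint_iff]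
  intro x y
  rw [PiLp.inner_apply, PiLp.inner_apply, ← Equiv.sum_comp σ]
  refine Finset.sum_congr rfl fun i _ => ?_
  have h := ha i
  simp only [RCLike.star_def] at h
  simp [hσ, h]
  ring

end WeightedPerm

/-! ### Exponentials, invariant subspaces and linear flows -/

/-- The exponential of a bounded operator preserves closed invariant subspaces. -/
theorem exp_apply_mem_of_invariant {H : Type*} [NormedAddCommGroup H] [NormedSpace ℂ H]
    [CompleteSpace H] (V : Submodule ℂ H) (hV : IsClosed (V : Set H)) (L : H →L[ℂ] H)
    (hL : ∀ v ∈ V, L v ∈ V) {v : H} (hv : v ∈ V) : NormedSpace.exp L v ∈ V := by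
  have h := (NormedSpace.exp_series_hasSum_exp' (𝕂 := ℂ) L).mapL
    (ContinuousLinearMap.apply ℂ H v)
  have hpow : ∀ n : ℕ, (L ^ n) v ∈ V := by
    intro n
    induction n with
    | zero => simpa using hv
    | succ n ih => rw [pow_succ']; exact hL _ ih
  refine hV.mem_of_tendsto h (Filter.Eventually.of_forall fun s => ?_)
  refine V.sum_mem fun n _ => ?_
  simpa using V.smul_mem _ (hpow n)

/-- A curve solving `v' = M v` is `v t = exp (t M) (v 0)`. -/
theorem exp_smul_apply_eq_of_hasDerivAt {H : Type*} [NormedAddCommGroup H] [NormedSpace ℂ H]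
    [CompleteSpace H] (M : H →L[ℂ] H) (v : ℝ → H) (hv : ∀ t, HasDerivAt v (M (v t)) t) (t : ℝ) :
    NormedSpace.exp ((t : ℂ) • M) (v 0) = v t := by
  -- This interpolates between the two sides, at `s = 0` and `s = t`, and has zero derivative.
  let g : ℝ → H := fun s => NormedSpace.exp ((t - s) • M) (v s)
  have hg : ∀ s, HasDerivAt g 0 s := by
    intro s
    have h1 : HasDerivAt (fun s : ℝ => NormedSpace.exp ((t - s) • M))
        ((-1 : ℝ) • (NormedSpace.exp ((t - s) • M) * M)) s :=
      (hasDerivAt_exp_smul_const (𝕂 := ℝ) M (t - s)).scomp s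
        ((hasDerivAt_id s).const_sub t)
    have h2 := ((ContinuousLinearMap.restrictScalarsL ℂ H H ℝ ℝ).hasFDerivAt.comp_hasDerivAt s
      h1).clm_apply (hv s)
    refine h2.congr_deriv ?_
    simp
  have h0 : g 0 = g t := is_const_of_deriv_eq_zero (fun s => (hg s).differentiableAt)
    (fun s => (hg s).deriv) 0 t
  simpa [g, Complex.coe_smul] using h0

/-! ### The alternating hoppings on a path -/

/-- The number of the site matched to site `i` by the edges `{2k, 2k+1}` of the path `0, …, 2m`. -/
def evenPartner (m i : ℕ) : ℕ := if i % 2 = 0 then (if i < 2 * m then i + 1 else i) else i - 1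

/-- The number of the site matched to site `i` by the edges `{2k+1, 2k+2}`. -/
def oddPartner (i : ℕ) : ℕ := if i % 2 = 0 then i - 1 else i + 1

/-- The matching `{2k, 2k+1}` as a permutation of the sites `0, …, 2m`. -/
def evenMatching (m : ℕ) : Equiv.Perm (Fin (2 * m + 1)) :=
  Function.Involutive.toPerm
    (fun i => ⟨evenPartner m i, by have := i.2; unfold evenPartner; split_ifs <;> omega⟩)
    (fun i => by
      ext
      have := i.2
      simp only [evenPartner]
      split_ifs <;> omega)

/-- The matching `{2k+1, 2k+2}` as a permutation of the sites `0, …, 2m`. -/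
def oddMatching (m : ℕ) : Equiv.Perm (Fin (2 * m + 1)) :=
  Function.Involutive.toPerm
    (fun i => ⟨oddPartner i, by have := i.2; unfold oddPartner; split_ifs <;> omega⟩)
    (fun i => by
      ext
      have := i.2
      simp only [oddPartner]
      split_ifs <;> omega)

theorem evenMatching_val (m : ℕ) (i : Fin (2 * m + 1)) :
    (evenMatching m i : ℕ) = evenPartner m i := rfl

theorem oddMatching_val (m : ℕ) (i : Fin (2 * m + 1)) :
    (oddMatching m i : ℕ) = oddPartner i := rfl

/-- Hopping amplitudes along the edges `{2k, 2k+1}`. -/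
def evenAmplitude (m i : ℕ) : ℝ := if i % 2 = 0 then (if i < 2 * m then 1 else 0) else -1

/-- Hopping amplitudes along the edges `{2k+1, 2k+2}`, of weight `w k`. -/
def oddAmplitude (w : ℕ → ℝ) (i : ℕ) : ℝ :=
  if i % 2 = 0 then (if i = 0 then 0 else w (i / 2 - 1)) else -w (i / 2)

/-- Unit-weight hopping on the edges `{2k, 2k+1}` of the path `0, …, 2m`. -/
noncomputable def evenHop (m : ℕ) :
    EuclideanSpace ℂ (Fin (2 * m + 1)) →L[ℂ] EuclideanSpace ℂ (Fin (2 * m + 1)) :=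
  weightedPerm (evenMatching m) fun i => (evenAmplitude m i : ℂ)

/-- Hopping on the edges `{2k+1, 2k+2}` of the path `0, …, 2m` with weights `w k`. -/
noncomputable def oddHop (m : ℕ) (w : ℕ → ℝ) :
    EuclideanSpace ℂ (Fin (2 * m + 1)) →L[ℂ] EuclideanSpace ℂ (Fin (2 * m + 1)) :=
  weightedPerm (oddMatching m) fun i => (oddAmplitude w i : ℂ)

theorem evenHop_apply_even {m k : ℕ} (hk : k < m) (v : EuclideanSpace ℂ (Fin (2 * m + 1))) :
    evenHop m v ⟨2 * k, by omega⟩ = v ⟨2 * k + 1, by omega⟩ := by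
  have h : evenMatching m ⟨2 * k, by omega⟩ = ⟨2 * k + 1, by omega⟩ := by
    ext
    simp [evenMatching_val, evenPartner, hk]
  rw [evenHop, weightedPerm_apply, h]
  simp [evenAmplitude, hk]

theorem evenHop_apply_last {m : ℕ} (v : EuclideanSpace ℂ (Fin (2 * m + 1))) :
    evenHop m v ⟨2 * m, by omega⟩ = 0 := by
  rw [evenHop, weightedPerm_apply]
  simp [evenAmplitude]

theorem evenHop_apply_odd {m k : ℕ} (hk : k < m) (v : EuclideanSpace ℂ (Fin (2 * m + 1))) :
    evenHop m v ⟨2 * k + 1, by omega⟩ = -v ⟨2 * k, by omega⟩ := by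
  have h : evenMatching m ⟨2 * k + 1, by omega⟩ = ⟨2 * k, by omega⟩ := by
    ext
    simp [evenMatching_val, evenPartner, Nat.add_mod]
  rw [evenHop, weightedPerm_apply, h]
  simp [evenAmplitude, Nat.add_mod]

theorem oddHop_apply_zero {m : ℕ} (w : ℕ → ℝ) (v : EuclideanSpace ℂ (Fin (2 * m + 1))) :
    oddHop m w v ⟨0, by omega⟩ = 0 := by
  rw [oddHop, weightedPerm_apply]
  simp [oddAmplitude]

theorem oddHop_apply_even {m k : ℕ} {w : ℕ → ℝ} (hk : k < m)
    (v : EuclideanSpace ℂ (Fin (2 * m + 1))) :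
    oddHop m w v ⟨2 * (k + 1), by omega⟩ = w k * v ⟨2 * k + 1, by omega⟩ := by
  have h : oddMatching m ⟨2 * (k + 1), by omega⟩ = ⟨2 * k + 1, by omega⟩ := by
    ext
    simp only [oddMatching_val, oddPartner]
    split_ifs <;> omega
  rw [oddHop, weightedPerm_apply, h]
  simp [oddAmplitude]

theorem oddHop_apply_odd {m k : ℕ} {w : ℕ → ℝ} (hk : k < m)
    (v : EuclideanSpace ℂ (Fin (2 * m + 1))) :
    oddHop m w v ⟨2 * k + 1, by omega⟩ = -(w k * v ⟨2 * (k + 1), by omega⟩) := by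
  have h : oddMatching m ⟨2 * k + 1, by omega⟩ = ⟨2 * (k + 1), by omega⟩ := by
    ext
    simp only [oddMatching_val, oddPartner]
    split_ifs <;> omega
  have h2 : (2 * k + 1) / 2 = k := by omega
  rw [oddHop, weightedPerm_apply, h]
  simp [oddAmplitude, h2, Nat.add_mod]

theorem evenHop_mem_skewAdjoint (m : ℕ) : evenHop m ∈ skewAdjoint
    (EuclideanSpace ℂ (Fin (2 * m + 1)) →L[ℂ] EuclideanSpace ℂ (Fin (2 * m + 1))) := by
  refine weightedPerm_mem_skewAdjoint _ _ (fun i => ?_) fun i => ?_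
  · exact Function.Involutive.toPerm_involutive _ i
  · have := i.2
    rw [RCLike.star_def, Complex.conj_ofReal, ← Complex.ofReal_neg, evenMatching_val]
    congr 1
    unfold evenAmplitude evenPartner
    split_ifs <;> first | omega | norm_num

theorem oddHop_mem_skewAdjoint (m : ℕ) (w : ℕ → ℝ) : oddHop m w ∈ skewAdjoint
    (EuclideanSpace ℂ (Fin (2 * m + 1)) →L[ℂ] EuclideanSpace ℂ (Fin (2 * m + 1))) := by
  refine weightedPerm_mem_skewAdjoint _ _ (fun i => ?_) fun i => ?_
  · exact Function.Involutive.toPerm_involutive _ i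
  · rw [RCLike.star_def, Complex.conj_ofReal, ← Complex.ofReal_neg, oddMatching_val]
    congr 1
    obtain ⟨i, hi⟩ := i
    rcases Nat.even_or_odd' i with ⟨k, rfl | rfl⟩
    · rcases k with _ | k
      · simp [oddAmplitude, oddPartner]
      · have h1 : oddPartner (2 * (k + 1)) = 2 * k + 1 := by unfold oddPartner; split_ifs <;> omega
        have h2 : (2 * k + 1) / 2 = k := by omega
        simp [oddAmplitude, h1, h2]
    · have h1 : oddPartner (2 * k + 1) = 2 * (k + 1) := by unfold oddPartner; split_ifs <;> omega
      have h2 : (2 * k + 1) / 2 = k := by omega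
      simp [oddAmplitude, h1, h2]

theorem norm_evenHop_le_one (m : ℕ) : ‖evenHop m‖ ≤ 1 := by
  refine norm_weightedPerm_le_one _ _ fun i => ?_
  rw [Complex.norm_real]
  unfold evenAmplitude
  split_ifs <;> norm_num

theorem norm_oddHop_le_one (m : ℕ) (w : ℕ → ℝ) (hw : ∀ k < m, |w k| ≤ 1) : ‖oddHop m w‖ ≤ 1 := by
  refine norm_weightedPerm_le_one _ _ fun i => ?_
  have := i.2
  rw [Complex.norm_real, Real.norm_eq_abs]
  unfold oddAmplitude
  split_ifs
  · simp
  · exact hw _ (by omega)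
  · rw [abs_neg]
    exact hw _ (by omega)

/-! ### Light cone of a product formula -/

/-- The vectors supported on the sites `0, …, r`. -/
def supportedUpTo (n r : ℕ) : Submodule ℂ (EuclideanSpace ℂ (Fin n)) where
  carrier := {v | ∀ i : Fin n, r < i → v i = 0}
  zero_mem' := fun _ _ => rfl
  add_mem' := fun {v w} hv hw i hi => by simp [hv i hi, hw i hi]
  smul_mem' := fun c v hv i hi => by simp [hv i hi]

theorem isClosed_supportedUpTo (n r : ℕ) :
    IsClosed (supportedUpTo n r : Set (EuclideanSpace ℂ (Fin n))) :=
  Submodule.closed_of_finiteDimensional _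

theorem supportedUpTo_mono (n r : ℕ) : supportedUpTo n r ≤ supportedUpTo n (r + 1) :=
  fun _ hv i hi => hv i (by omega)

theorem weightedPerm_apply_mem_supportedUpTo {n r : ℕ} (σ : Equiv.Perm (Fin n)) (a : Fin n → ℂ)
    (hσ : ∀ i : Fin n, r < i → r < σ i) (v : EuclideanSpace ℂ (Fin n))
    (hv : v ∈ supportedUpTo n r) : weightedPerm σ a v ∈ supportedUpTo n r := by
  intro i hi
  rw [weightedPerm_apply, hv _ (hσ i hi), mul_zero]

/-- For odd `r` no edge `{2k, 2k+1}` crosses the cut between `r` and `r + 1`. -/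
theorem evenHop_apply_mem_supportedUpTo {m r : ℕ} (hr : r % 2 = 1)
    (v : EuclideanSpace ℂ (Fin (2 * m + 1))) (hv : v ∈ supportedUpTo _ r) :
    evenHop m v ∈ supportedUpTo _ r := by
  refine weightedPerm_apply_mem_supportedUpTo _ _ (fun i hi => ?_) v hv
  rw [evenMatching_val]
  unfold evenPartner
  split_ifs <;> omega

theorem oddHop_apply_mem_supportedUpTo {m r : ℕ} {w : ℕ → ℝ} (hr : r % 2 = 0)
    (v : EuclideanSpace ℂ (Fin (2 * m + 1))) (hv : v ∈ supportedUpTo _ r) :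
    oddHop m w v ∈ supportedUpTo _ r := by
  refine weightedPerm_apply_mem_supportedUpTo _ _ (fun i hi => ?_) v hv
  rw [oddMatching_val]
  unfold oddPartner
  split_ifs <;> omega

/-- One exponential enlarges the support by at most one site. -/
theorem exp_hop_apply_mem_supportedUpTo (m r : ℕ) (w : ℕ → ℝ) (g : Generator) (s : ℂ)
    (v : EuclideanSpace ℂ (Fin (2 * m + 1))) (hv : v ∈ supportedUpTo _ r) :
    NormedSpace.exp (s • g.toOp (evenHop m) (oddHop m w)) v ∈ supportedUpTo _ (r + 1) := by
  have key : ∀ (q : ℕ) (L : EuclideanSpace ℂ (Fin (2 * m + 1)) →L[ℂ]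
      EuclideanSpace ℂ (Fin (2 * m + 1))),
      (∀ v ∈ supportedUpTo _ q, L v ∈ supportedUpTo _ q) → v ∈ supportedUpTo _ q →
        NormedSpace.exp (s • L) v ∈ supportedUpTo _ q := by
    intro q L hL hq
    refine exp_apply_mem_of_invariant (supportedUpTo (2 * m + 1) q)
      (isClosed_supportedUpTo _ q) (s • L) (fun u hu => ?_) hq
    rw [smul_apply]
    exact Submodule.smul_mem _ s (hL u hu)
  -- Only one matching contains the edge `{r, r+1}`. Its hopping preserves the enlarged space; the
  -- other already preserves the original one.
  have hv' := supportedUpTo_mono _ _ hv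
  rcases Nat.mod_two_eq_zero_or_one r with h | h <;> cases g
  · exact key _ _ (evenHop_apply_mem_supportedUpTo (by omega)) hv'
  · exact supportedUpTo_mono _ _ (key _ _ (oddHop_apply_mem_supportedUpTo h) hv)
  · exact supportedUpTo_mono _ _ (key _ _ (evenHop_apply_mem_supportedUpTo h) hv)
  · exact key _ _ (oddHop_apply_mem_supportedUpTo (by omega)) hv'

/-- A product formula moves site `0` at most as far as it has exponentials. -/
theorem ProductFormula.eval_hop_apply_mem_supportedUpTo (m : ℕ) (w : ℕ → ℝ) (F : ProductFormula)
    (v : EuclideanSpace ℂ (Fin (2 * m + 1))) (hv : v ∈ supportedUpTo _ 0) :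
    F.eval (evenHop m) (oddHop m w) v ∈ supportedUpTo _ F.numExp := by
  induction F with
  | nil => simpa [ProductFormula.eval, ProductFormula.numExp] using hv
  | cons f F ih =>
    have h := exp_hop_apply_mem_supportedUpTo m (ProductFormula.numExp F) w f.1 f.2 _ ih
    simpa [ProductFormula.eval, ProductFormula.numExp] using h

/-- The value of a product formula at anti-Hermitian operators is unitary. -/
theorem ProductFormula.eval_mem_unitary {H : Type*} [NormedAddCommGroup H] [InnerProductSpace ℂ H]
    [CompleteSpace H] (F : ProductFormula) {A B : H →L[ℂ] H} (hA : A ∈ skewAdjoint (H →L[ℂ] H))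
    (hB : B ∈ skewAdjoint (H →L[ℂ] H)) : F.eval A B ∈ unitary (H →L[ℂ] H) := by
  refine Submonoid.list_prod_mem _ fun L hL => ?_
  obtain ⟨⟨g, s⟩, -, rfl⟩ := List.mem_map.mp hL
  let +nondep : NormedAlgebra ℚ (H →L[ℂ] H) := .restrictScalars ℚ ℂ _
  apply NormedSpace.exp_mem_unitary_of_mem_skewAdjoint
  rw [Complex.coe_smul]
  cases g
  · exact skewAdjoint.smul_mem s hA
  · exact skewAdjoint.smul_mem s hB

/-! ### Spin coherent states and perfect state transfer -/

/-- Binomial amplitudes `√(m choose k) cos^(m-k) x sin^k x` of a spin coherent state. -/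
noncomputable def coherentAmplitude (m k : ℕ) (x : ℝ) : ℝ :=
  √(m.choose k : ℝ) * (Real.cos x ^ (m - k) * Real.sin x ^ k)

/-- The hopping weights `√((k+1)(m-k))` of the chain with perfect state transfer. -/
noncomputable def transferWeight (m k : ℕ) : ℝ := √(((k + 1) * (m - k : ℕ) : ℕ) : ℝ)

/-- This ladder relation and the next are `(k+1) C(m,k+1) = (m-k) C(m,k)` under square roots; they
turn the product rule for the amplitudes into hopping. -/
theorem transferWeight_mul_sqrt_choose (m k : ℕ) :
    transferWeight m k * √(m.choose k : ℝ) = (k + 1) * √(m.choose (k + 1) : ℝ) := by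
  have h := Nat.choose_succ_right_eq m k
  rw [transferWeight, ← Real.sqrt_mul (Nat.cast_nonneg _), ← Real.sqrt_sq (by positivity : (0 : ℝ) ≤ k + 1),
    ← Real.sqrt_mul (sq_nonneg _)]
  congr 1
  have h' : (m.choose (k + 1) : ℝ) * (k + 1) = m.choose k * (m - k : ℕ) := by exact_mod_cast h
  push_cast
  linear_combination (-(k + 1 : ℝ)) * h'

theorem transferWeight_mul_sqrt_choose_succ (m k : ℕ) :
    transferWeight m k * √(m.choose (k + 1) : ℝ) = (m - k : ℕ) * √(m.choose k : ℝ) := by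
  have h := Nat.choose_succ_right_eq m k
  rw [transferWeight, ← Real.sqrt_mul (Nat.cast_nonneg _),
    ← Real.sqrt_sq (Nat.cast_nonneg (m - k) : (0 : ℝ) ≤ (m - k : ℕ)),
    ← Real.sqrt_mul (sq_nonneg _)]
  congr 1
  have h' : (m.choose (k + 1) : ℝ) * (k + 1) = m.choose k * (m - k : ℕ) := by exact_mod_cast h
  push_cast
  linear_combination ((m - k : ℕ) : ℝ) * h'

/-- AM-GM for the factors `k + 1` and `m - k`; it controls the norm of `B`. -/
theorem transferWeight_le (m k : ℕ) (hk : k ≤ m) : transferWeight m k ≤ (m + 1) / 2 := by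
  rw [transferWeight, Real.sqrt_le_left (by positivity)]
  push_cast [hk]
  nlinarith [sq_nonneg ((m : ℝ) - 2 * k - 1)]

theorem hasDerivAt_coherentAmplitude_zero (m : ℕ) (x : ℝ) :
    HasDerivAt (coherentAmplitude m 0) (-(transferWeight m 0 * coherentAmplitude m 1 x)) x := by
  have h := ((Real.hasDerivAt_cos x).pow m).const_mul √(m.choose 0 : ℝ)
  have e := transferWeight_mul_sqrt_choose_succ m 0
  unfold coherentAmplitude
  simp only [Nat.sub_zero, pow_zero, mul_one, pow_one, zero_add] at h e ⊢
  refine h.congr_deriv ?_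
  linear_combination (Real.cos x ^ (m - 1) * Real.sin x) * e

theorem hasDerivAt_coherentAmplitude_succ (m k : ℕ) (x : ℝ) :
    HasDerivAt (coherentAmplitude m (k + 1))
      (transferWeight m k * coherentAmplitude m k x
        - transferWeight m (k + 1) * coherentAmplitude m (k + 2) x) x := by
  have h := (((Real.hasDerivAt_cos x).pow (m - (k + 1))).mul
    ((Real.hasDerivAt_sin x).pow (k + 1))).const_mul √(m.choose (k + 1) : ℝ)
  have e1 := transferWeight_mul_sqrt_choose m k
  have e2 := transferWeight_mul_sqrt_choose_succ m (k + 1)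
  refine h.congr_deriv ?_
  unfold coherentAmplitude
  -- For `k ≥ m` the binomials and the weight vanish, so truncated subtraction is harmless.
  rcases Nat.lt_or_ge k m with hk | hk
  · have e3 : m - k = (m - (k + 1)) + 1 := by omega
    have e4 : m - (k + 2) = m - (k + 1) - 1 := by omega
    rw [e3, e4]
    simp only [add_tsub_cancel_right, Pi.pow_apply]
    push_cast
    rw [pow_succ (Real.cos x), pow_succ (Real.sin x) (k + 1), pow_succ (Real.sin x) k]
    linear_combination (-(Real.cos x ^ (m - (k + 1)) * Real.cos x * Real.sin x ^ k)) * e1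
      + (Real.cos x ^ (m - (k + 1) - 1) * (Real.sin x ^ k * Real.sin x * Real.sin x)) * e2
  · have e3 : transferWeight m k = 0 := by simp [transferWeight, Nat.sub_eq_zero_of_le hk]
    simp [Nat.choose_eq_zero_of_lt (show m < k + 1 by omega),
      Nat.choose_eq_zero_of_lt (show m < k + 2 by omega), e3]

/-- The coherent amplitudes placed on the even sites of the path `0, …, 2m`. -/
noncomputable def coherentState (m : ℕ) (x : ℝ) : EuclideanSpace ℂ (Fin (2 * m + 1)) :=
  WithLp.toLp 2 fun i =>
    if (i : ℕ) % 2 = 0 then (coherentAmplitude m ((i : ℕ) / 2) x : ℂ) else 0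

theorem coherentState_apply (m : ℕ) (x : ℝ) (i : Fin (2 * m + 1)) : coherentState m x i =
    if (i : ℕ) % 2 = 0 then (coherentAmplitude m ((i : ℕ) / 2) x : ℂ) else 0 := rfl

theorem coherentState_apply_even (m : ℕ) (x : ℝ) (k : ℕ) (hk : 2 * k < 2 * m + 1) :
    coherentState m x ⟨2 * k, hk⟩ = coherentAmplitude m k x := by
  simp [coherentState_apply]

theorem coherentState_zero (m : ℕ) :
    coherentState m 0 = EuclideanSpace.single 0 1 := by
  ext i
  rw [coherentState_apply, PiLp.single_apply]
  by_cases hi : i = 0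
  · subst hi; simp [coherentAmplitude]
  · have : (i : ℕ) ≠ 0 := fun h => hi (Fin.ext h)
    rw [if_neg hi]
    split_ifs
    · have : (i : ℕ) / 2 ≠ 0 := by omega
      simp [coherentAmplitude, this]
    · rfl

theorem coherentState_pi_div_two (m : ℕ) :
    coherentState m (Real.pi / 2) = EuclideanSpace.single (Fin.last (2 * m)) 1 := by
  ext i
  rw [coherentState_apply, PiLp.single_apply]
  by_cases hi : i = Fin.last (2 * m)
  · subst hi; simp [coherentAmplitude]
  · have : (i : ℕ) ≠ 2 * m := fun h => hi (Fin.ext h)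
    have := i.2
    rw [if_neg hi]
    split_ifs
    · have : m - (i : ℕ) / 2 ≠ 0 := by omega
      simp [coherentAmplitude, this]
    · rfl

theorem hasDerivAt_euclidean_of_forall {ι : Type*} [Fintype ι] {f : ℝ → EuclideanSpace ℂ ι}
    {f' : EuclideanSpace ℂ ι} {t : ℝ} (h : ∀ i, HasDerivAt (fun x => f x i) (f' i) t) :
    HasDerivAt f f' t :=
  (PiLp.continuousLinearEquiv 2 ℝ fun _ : ι => ℂ).symm.hasFDerivAt.comp_hasDerivAt t
    (hasDerivAt_pi.2 h)

/-- The commutator of the two hoppings rotates the coherent states. -/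
theorem hasDerivAt_coherentState (m : ℕ) (μ t : ℝ) :
    HasDerivAt (fun t : ℝ => coherentState m (μ * t))
      (⁅evenHop m, oddHop m fun k => μ * transferWeight m k⁆ (coherentState m (μ * t))) t := by
  refine hasDerivAt_euclidean_of_forall fun i => ?_
  have hμ (k : ℕ) {d : ℝ} (h : HasDerivAt (coherentAmplitude m k) d (μ * t)) :
      HasDerivAt (fun t : ℝ => (coherentAmplitude m k (μ * t) : ℂ)) ((d * μ : ℝ) : ℂ) t := by
    simpa using (h.comp t ((hasDerivAt_id t).const_mul μ)).ofReal_comp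
  -- The derivative formula at the end of the chain refers to a site beyond it, whose amplitude is
  -- zero.
  have hlast : coherentAmplitude m (m + 1) (μ * t) = 0 := by simp [coherentAmplitude]
  obtain ⟨i, hi⟩ := i
  rw [Ring.lie_def, sub_apply, PiLp.sub_apply]
  change HasDerivAt _ (evenHop m (oddHop m _ _) _ - oddHop m _ (evenHop m _) _) t
  simp only [coherentState_apply]
  rcases Nat.even_or_odd' i with ⟨k, rfl | rfl⟩
  · simp only [Nat.mul_mod_right, if_true, Nat.mul_div_cancel_left k two_pos]
    rcases k with _ | k
    · refine (hμ 0 (hasDerivAt_coherentAmplitude_zero m (μ * t))).congr_deriv ?_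
      change _ = _ - oddHop m _ (evenHop m _) ⟨0, by omega⟩
      rw [oddHop_apply_zero]
      rcases Nat.eq_zero_or_pos m with rfl | hm
      · have h := evenHop_apply_last (m := 0)
          (oddHop 0 (fun k => μ * transferWeight 0 k) (coherentState 0 (μ * t)))
        rw [show (⟨2 * 0, hi⟩ : Fin (2 * 0 + 1)) = ⟨2 * 0, by omega⟩ from rfl, h]
        simp [transferWeight]
      · rw [evenHop_apply_even hm, oddHop_apply_odd hm, coherentState_apply_even]
        push_cast
        ring
    · refine (hμ (k + 1) (hasDerivAt_coherentAmplitude_succ m k (μ * t))).congr_deriv ?_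
      rw [oddHop_apply_even (by omega), evenHop_apply_odd (by omega), coherentState_apply_even]
      rcases Nat.lt_or_ge (k + 1) m with hk | hk
      · rw [evenHop_apply_even hk, oddHop_apply_odd hk, coherentState_apply_even]
        push_cast
        ring
      · obtain rfl : m = k + 1 := by omega
        rw [evenHop_apply_last, hlast]
        push_cast
        ring
  · have h1 : (2 * k + 1) % 2 ≠ 0 := by omega
    simp only [if_neg h1]
    refine (hasDerivAt_const t (0 : ℂ)).congr_deriv ?_
    rw [oddHop_apply_odd (by omega), evenHop_apply_odd (by omega)]
    have hodd (j : ℕ) (hj : 2 * j + 1 < 2 * m + 1) :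
        coherentState m (μ * t) ⟨2 * j + 1, hj⟩ = 0 := by
      rw [coherentState_apply, if_neg (show (2 * j + 1) % 2 ≠ 0 by omega)]
    -- The state vanishes on odd sites, so both orders of hopping give zero there.
    have he : evenHop m (coherentState m (μ * t)) ⟨2 * (k + 1), by omega⟩ = 0 := by
      rcases Nat.lt_or_ge (k + 1) m with hk | hk
      · rw [evenHop_apply_even hk, hodd]
      · obtain rfl : m = k + 1 := by omega
        exact evenHop_apply_last _
    rw [he]
    rcases k with _ | k
    · change _ = -oddHop m _ _ ⟨0, by omega⟩ - _
      rw [oddHop_apply_zero]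
      simp
    · rw [oddHop_apply_even (by omega), hodd]
      simp

theorem exp_commutator_hop_apply (m : ℕ) {T : ℝ} (hT : 0 < T) :
    NormedSpace.exp ((T : ℂ) •
      ⁅evenHop m, oddHop m fun k => Real.pi / (2 * T) * transferWeight m k⁆)
        (EuclideanSpace.single 0 1) = EuclideanSpace.single (Fin.last (2 * m)) 1 := by
  have h := exp_smul_apply_eq_of_hasDerivAt _ _
    (fun t => hasDerivAt_coherentState m (Real.pi / (2 * T)) t) T
  have e : Real.pi / (2 * T) * T = Real.pi / 2 := by field_simp
  rwa [mul_zero, e, coherentState_zero, coherentState_pi_div_two] at h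

/-! ### The lower bound -/

/-- A product formula for the transfer chain that is closer than `√2` to the evolution has at least
as many exponentials as the path has edges. -/
theorem two_mul_le_numExp_of_approximates {m : ℕ} {T ε : ℝ} (hT : 0 < T) (hε : ε < √2)
    (F : ProductFormula)
    (hF : F.Approximates (evenHop m) (oddHop m fun k => Real.pi / (2 * T) * transferWeight m k)
      T ε) : 2 * m ≤ F.numExp := by
  by_contra! hN
  set A := evenHop m
  set B := oddHop m fun k => Real.pi / (2 * T) * transferWeight m k
  set e₀ : EuclideanSpace ℂ (Fin (2 * m + 1)) := EuclideanSpace.single 0 1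
  have h0 : e₀ ∈ supportedUpTo _ 0 := by
    intro i hi
    have : i ≠ 0 := by rintro rfl; simp at hi
    simp [e₀, this]
  have hsupp : F.eval A B e₀ (Fin.last (2 * m)) = 0 :=
    ProductFormula.eval_hop_apply_mem_supportedUpTo m _ F e₀ h0 _ hN
  have hnorm : ‖F.eval A B e₀‖ = 1 := by
    have hu := F.eval_mem_unitary (evenHop_mem_skewAdjoint m)
      (oddHop_mem_skewAdjoint m fun k => Real.pi / (2 * T) * transferWeight m k)
    rw [ContinuousLinearMap.norm_map_of_mem_unitary hu]
    simp [e₀]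
  -- Pythagoras for orthogonal unit vectors.
  have hdist : ‖F.eval A B e₀ - EuclideanSpace.single (Fin.last (2 * m)) 1‖ ^ 2 = 2 := by
    rw [@norm_sub_sq ℂ, hnorm, EuclideanSpace.inner_single_right, hsupp]
    simp
    norm_num
  have hle : ‖F.eval A B e₀ - EuclideanSpace.single (Fin.last (2 * m)) 1‖ ≤ ε := by
    rw [← exp_commutator_hop_apply m hT]
    refine le_trans ?_ hF
    have h := (F.eval A B - NormedSpace.exp ((T : ℂ) • ⁅A, B⁆)).le_opNorm e₀
    rwa [sub_apply, PiLp.norm_single, norm_one, mul_one] at h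
  rw [← Real.sqrt_sq (norm_nonneg _), hdist] at hle
  exact absurd hle (not_le.mpr hε)

theorem mainTheorem7 (ε : ℝ) (hε₀ : 0 ≤ ε) (hε : ε < Real.sqrt 2) :
    ∃ c : ℝ, 0 < c ∧ ∃ T₀ : ℝ, ∀ T : ℝ, T₀ ≤ T →
      (∀ F : ProductFormula, F.ApproximatesGeneric T ε → c * T ≤ (F.numExp : ℝ)) ∧
      (∃ (n : ℕ) (A B : EuclideanSpace ℂ (Fin n) →L[ℂ] EuclideanSpace ℂ (Fin n)),
        A ∈ skewAdjoint (EuclideanSpace ℂ (Fin n) →L[ℂ] EuclideanSpace ℂ (Fin n)) ∧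
        B ∈ skewAdjoint (EuclideanSpace ℂ (Fin n) →L[ℂ] EuclideanSpace ℂ (Fin n)) ∧
        ‖A‖ ≤ 1 ∧ ‖B‖ ≤ 1 ∧
        ∀ F : ProductFormula, F.Approximates A B T ε → c * T ≤ (F.numExp : ℝ)) := by
  -- `T ≥ 4` gives `3.15 (T+1)/2 ≤ 2T`, which bounds `‖B‖`, and `2⌊T⌋ ≥ T`, which gives `c = 1`.
  refine ⟨1, one_pos, 4, fun T hT => ?_⟩
  rw [one_mul]
  have hT0 : 0 < T := by linarith
  have hm1 := Nat.floor_le hT0.le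
  have hm2 := Nat.lt_floor_add_one T
  set m := ⌊T⌋₊
  set B := oddHop m fun k => Real.pi / (2 * T) * transferWeight m k
  have hB : ‖B‖ ≤ 1 := by
    refine norm_oddHop_le_one _ _ fun k hk => ?_
    have h1 := transferWeight_le m k hk.le
    have h2 : 0 ≤ transferWeight m k := Real.sqrt_nonneg _
    have h3 := Real.pi_pos
    have h4 := Real.pi_lt_d2
    rw [abs_of_nonneg (by positivity), div_mul_eq_mul_div, div_le_one (by positivity)]
    calc Real.pi * transferWeight m k ≤ 3.15 * ((T + 1) / 2) := by
          gcongr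
          linarith
      _ ≤ 2 * T := by linarith
  have hlower : ∀ F : ProductFormula, F.Approximates (evenHop m) B T ε → T ≤ F.numExp := by
    intro F hF
    have h : ((2 * m : ℕ) : ℝ) ≤ F.numExp :=
      Nat.cast_le.mpr (two_mul_le_numExp_of_approximates hT0 hε F hF)
    push_cast at h
    linarith
  exact ⟨fun F hF => hlower F (hF _ _ _ (evenHop_mem_skewAdjoint m) (oddHop_mem_skewAdjoint m _)
      (norm_evenHop_le_one m) hB),
    _, _, _, evenHop_mem_skewAdjoint m, oddHop_mem_skewAdjoint m _, norm_evenHop_le_one m, hB,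
    hlower⟩
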